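/- Let $G=(V,E)$ be a connected, locally finite, simple undirected graph that is $C_4$-free, i.e. does not contain the cycle $C_4$ as a (not necessarily induced) subgraph. For $f,g:V\to\mathbb R$ let $\Delta f(x)=\sum_{y\sim x}(f(y)-f(x))$ be the unweighted non-normalized Laplacian and put $$2\Gamma(f,g)=\Delta(fg)-f\Delta g-g\Delta f,\qquad 2\Gamma_2(f,g)=\Delta\Gamma(f,g)-\Gamma(f,\Delta g)-\Gamma(\Delta f,g).$$ We say that $G$ satisfies $CD(0,\infty)$ if $\Gamma_2(f,f)(x)\ge 0$ for all $x\in V$ and all $f:V\to\mathbb R$. Then $G$ satisfies $CD(0,\infty)$ if and only if $G$ is isomorphic to one of the following graphs: (1) a path $P_k$ with $k$ vertices ($k\ge 1$), a cycle $C_n$ with $n\ge 5$, the infinite line $P_{\mathbb Z}$ (vertex set $\mathbb Z$, with consecutive integers adjacent), or the infinite half line $P_{\mathbb N}$ (vertex set $\mathbb N$, with consecutive integers adjacent); (2) the star $\mathrm{Star}_3$ (one central vertex joined to three leaves, i.e. $K_{1,3}$); (3) the triangle $C_3$, or the graph $C_3'$ obtained from a triangle by attaching exactly one pendant edge at one of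 its vertices (four vertices, four edges). -/

import Mathlib

namespace BakryEmery

variable {V : Type*} (G : SimpleGraph V) [G.LocallyFinite]

/-- The unweighted non-normalized Laplacian (edge weights `1`, vertex weights `1`):
`Δ f (x) = ∑_{y ∼ x} (f y - f x)`. -/
def laplacian (f : V → ℝ) (x : V) : ℝ :=
  ∑ y ∈ G.neighborFinset x, (f y - f x)

/-- `2 Γ(f, g) = Δ(f g) - f Δ g - g Δ f`. -/
noncomputable def Gam (f g : V → ℝ) (x : V) : ℝ :=
  (laplacian G (fun y => f y * g y) x - f x * laplacian G g x - g x * laplacian G f x) / 2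

/-- `2 Γ₂(f, g) = Δ Γ(f, g) - Γ(f, Δ g) - Γ(Δ f, g)`. -/
noncomputable def Gam2 (f g : V → ℝ) (x : V) : ℝ :=
  (laplacian G (Gam G f g) x - Gam G f (laplacian G g) x - Gam G (laplacian G f) g x) / 2

/-- The condition `CD(K, N, x)` at a vertex `x`, for `K ∈ ℝ` and `N ∈ (0, ∞]`:
`Γ₂(f)(x) ≥ (1/N) (Δ f(x))² + K Γ(f)(x)` for every `f : V → ℝ`.
For `N = ⊤` the coefficient `1/N` is `0`. -/
def CDAt (K : ℝ) (N : ENNReal) (x : V) : Prop :=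
  ∀ f : V → ℝ, Gam2 G f f x ≥ (N⁻¹).toReal * (laplacian G f x) ^ 2 + K * Gam G f f x

/-- The graph satisfies `CD(K, N)` if all of its vertices do. -/
def CD (K : ℝ) (N : ENNReal) : Prop :=
  ∀ x : V, CDAt G K N x

/-- A triangle `0, 1, 2` with exactly one pendant edge, joining the triangle vertex `0` to the
fourth vertex `3`. -/
def trianglePendant : SimpleGraph (Fin 4) :=
  SimpleGraph.fromEdgeSet {s(0, 1), s(1, 2), s(0, 2), s(0, 3)}

end BakryEmery

/-!
Fix a vertex `x`, and write `a y = f y - f x` and `D = ∑ a y`, where `y` runs over the neighbours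
of `x`. Completing squares (`four_mul_Gam2`) gives
`4 Γ₂(f)(x) = 2 D² + ∑_y (4 - d_y - d_x) (a y)² + ∑_y ∑_{z ∼ y, z ≠ x} (f z - f x - 2 a y)²`.

If the degrees of adjacent vertices add up to at most `4`, every term is nonnegative. This settles
all the graphs of the list except the triangle with a pendant edge, where the form is computed.

Conversely, without `C₄` every vertex at distance two from `x` has exactly one neighbour adjacent
to `x`, so `f` can be chosen to annihilate its square; and `y` has at most one common neighbour with
`x`. For `a` constant on triangles with `D = 0` there remains
`0 ≤ ∑_y (4 - d_y - d_x + τ_y) (a y)²` with `τ_y = |N(y) ∩ N(x)| ≤ d_y - 1` (`CD.sum_nonneg`).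
The coefficients are at most `3 - d_x`. When `d_x ≥ 3` there is such an `a` without zeros, so
`d_x = 3` and `d_y = 1 + τ_y` for all `y` (`CD.of_three_le_degree`). Hence all vertices lie in the
unit ball around `x`, which spans the star or the triangle with a pendant edge.

If all degrees are at most two, the graph is a path, a cycle, a half line or a line. From a vertex
with at most one neighbour, the distance function identifies the graph with an initial segment of
`ℕ` (`path_or_ray`). If all degrees equal two, following the darts without turning back covers the
graph by `ℤ`; the covering is bijective or periodic (`IsLineCover.iso_int`,
`IsLineCover.exists_period`, `IsLineCover.iso_cycle`).
-/

namespace BakryEmery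

/-! ### Connected graphs with at most two neighbours at every vertex -/

section Classification

open SimpleGraph

variable {V : Type*} {G : SimpleGraph V}

theorem mem_of_adj_closed (hG : G.Connected) {S : Set V} {v : V} (hv : v ∈ S)
    (hS : ∀ x ∈ S, ∀ y, G.Adj x y → y ∈ S) (w : V) : w ∈ S := by
  obtain ⟨p⟩ := hG.preconnected v w
  induction p with
  | nil => exact hv
  | cons h _ ih => exact ih (hS _ hv _ h)

theorem exists_adj_dist_eq (hG : G.Connected) {v x : V} {n : ℕ} (h : G.dist v x = n + 1) :
    ∃ p, G.Adj x p ∧ G.dist v p = n := by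
  obtain ⟨w, hw⟩ := hG.exists_walk_length_eq_dist x v
  rw [dist_comm, h] at hw
  cases w with
  | nil => simp at hw
  | @cons _ p _ hadj w =>
    refine ⟨p, hadj, ?_⟩
    have h1 : G.dist v p ≤ n := by
      rw [dist_comm]
      exact (dist_le w).trans (by simpa using hw.le)
    have h2 := hG.dist_triangle (u := v) (v := p) (w := x)
    rw [dist_eq_one_iff_adj.2 hadj.symm] at h2
    omega

theorem nonempty_iso_of_bijective {W : Type*} {H : SimpleGraph W} (f : V → W)
    (hf : Function.Bijective f) (h : ∀ x y, H.Adj (f x) (f y) ↔ G.Adj x y) :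
    Nonempty (G ≃g H) :=
  ⟨⟨Equiv.ofBijective f hf, h _ _⟩⟩

/-- Every vertex has at most two neighbours. -/
def AtMostTwoNeighbors (G : SimpleGraph V) : Prop :=
  ∀ x a b c, G.Adj x a → G.Adj x b → G.Adj x c → a = b ∨ a = c ∨ b = c

/-- Seen from a vertex with at most one neighbour, every sphere has at most one point: the unique
point of the sphere of radius `n` spends one of its two neighbours on the sphere below. -/
theorem dist_injective (hG : G.Connected) (hdeg : AtMostTwoNeighbors G) {v : V}
    (hv : ∀ a b, G.Adj v a → G.Adj v b → a = b) : Function.Injective (G.dist v) := by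
  have key : ∀ n x y, G.dist v x = n → G.dist v y = n → x = y := by
    intro n
    induction n with
    | zero =>
      intro x y hx hy
      rw [← hG.dist_eq_zero_iff.1 hx, ← hG.dist_eq_zero_iff.1 hy]
    | succ n ih =>
      intro x y hx hy
      obtain ⟨p, hxp, hp⟩ := exists_adj_dist_eq hG hx
      obtain ⟨q, hyq, hq⟩ := exists_adj_dist_eq hG hy
      obtain rfl := ih p q hp hq
      cases n with
      | zero =>
        obtain rfl := hG.dist_eq_zero_iff.1 hp
        exact hv _ _ hxp.symm hyq.symm
      | succ n =>
        obtain ⟨r, hpr, hr⟩ := exists_adj_dist_eq hG hp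
        rcases hdeg p x y r hxp.symm hyq.symm hpr with h | h | h
        · exact h
        · rw [h] at hx; omega
        · rw [h] at hy; omega
  exact fun x y h => key _ x y h rfl

theorem adj_iff_dist (hG : G.Connected) {v : V} (hinj : Function.Injective (G.dist v)) (x y : V) :
    G.Adj x y ↔ G.dist v x + 1 = G.dist v y ∨ G.dist v y + 1 = G.dist v x := by
  have key : ∀ x y, G.dist v x + 1 = G.dist v y → G.Adj x y := by
    intro x y h
    obtain ⟨p, hyp, hp⟩ := exists_adj_dist_eq hG h.symm
    rw [← hinj hp]
    exact hyp.symm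
  refine ⟨fun h => ?_, fun h => h.elim (key x y) fun h => (key y x h).symm⟩
  have h1 := hG.dist_triangle (u := v) (v := x) (w := y)
  have h2 := hG.dist_triangle (u := v) (v := y) (w := x)
  rw [dist_eq_one_iff_adj.2 h] at h1
  rw [dist_eq_one_iff_adj.2 h.symm] at h2
  have h3 : G.dist v x ≠ G.dist v y := fun e => h.ne (hinj e)
  omega

theorem path_or_ray (hG : G.Connected) (hdeg : AtMostTwoNeighbors G) {v : V}
    (hv : ∀ a b, G.Adj v a → G.Adj v b → a = b) :
    (∃ k : ℕ, 1 ≤ k ∧ Nonempty (G ≃g pathGraph k)) ∨ Nonempty (G ≃g hasse ℕ) := by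
  classical
  have hinj := dist_injective hG hdeg hv
  have hadj := adj_iff_dist hG hinj
  by_cases hs : ∃ n, ∀ x, G.dist v x ≠ n
  · left
    have hmin : ∀ x, G.dist v x < Nat.find hs := by
      have hup : ∀ n, Nat.find hs ≤ n → ∀ x, G.dist v x ≠ n := by
        intro n hn
        induction n, hn using Nat.le_induction with
        | base => exact Nat.find_spec hs
        | succ n hn ih =>
          intro x hx
          obtain ⟨p, -, hp⟩ := exists_adj_dist_eq hG hx
          exact ih p hp
      intro x
      by_contra h
      exact hup _ (not_lt.1 h) x rfl
    refine ⟨Nat.find hs, (hmin v).pos, nonempty_iso_of_bijective (fun x => ⟨G.dist v x, hmin x⟩)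
      ⟨fun x y h => hinj (by simpa using h), fun n => ?_⟩ ?_⟩
    · have := Nat.find_min hs n.2
      push Not at this
      exact this.imp fun x hx => Fin.ext hx
    · intro x y
      simp [pathGraph_adj, hadj]
  · right
    push Not at hs
    refine nonempty_iso_of_bijective (G.dist v) ⟨hinj, hs⟩ ?_
    intro x y
    simp [hasse_adj, hadj, Nat.covBy_iff_add_one_eq]

/-! ### The two-regular case: coverings by the line -/

/-- A bi-infinite non-backtracking walk that exhausts the neighbourhoods of its vertices, in other
words a covering of `G` by the line. -/
structure IsLineCover (G : SimpleGraph V) (φ : ℤ → V) : Prop where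
  adj_iff : ∀ i x, G.Adj (φ i) x ↔ x = φ (i - 1) ∨ x = φ (i + 1)
  ne : ∀ i, φ (i - 1) ≠ φ (i + 1)
  surj : Function.Surjective φ
  /-- Two consecutive values determine the walk. -/
  rigid : ∀ i j, φ i = φ j → φ (i + 1) = φ (j + 1) → ∀ k, φ (i + k) = φ (j + k)

/-- If every vertex has exactly two neighbours, then moving every dart one step ahead without
turning back is a permutation of the darts, whose orbits are the walks sought. -/
theorem exists_isLineCover (hG : G.Connected) (hdeg : AtMostTwoNeighbors G)
    (htwo : ∀ v, ∃ a b, a ≠ b ∧ G.Adj v a ∧ G.Adj v b) : ∃ φ, IsLineCover G φ := by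
  have hother : ∀ d : G.Dart, ∃ w, w ≠ d.fst ∧ G.Adj d.snd w := by
    intro d
    obtain ⟨a, b, hab, ha, hb⟩ := htwo d.snd
    by_cases h : a = d.fst
    · exact ⟨b, fun hb => hab (h.trans hb.symm), hb⟩
    · exact ⟨a, h, ha⟩
  -- `o d` is the vertex that follows the dart `d`
  choose o ho hadj using hother
  have huniq : ∀ (d : G.Dart) w, w ≠ d.fst → G.Adj d.snd w → w = o d := by
    intro d w hw hwd
    rcases hdeg d.snd w d.fst (o d) hwd d.adj.symm (hadj d) with h | h | h
    · exact absurd h hw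
    · exact h
    · exact absurd h.symm (ho d)
  let next : G.Dart → G.Dart := fun d => ⟨(d.snd, o d), hadj d⟩
  -- Stepping ahead, turning around and stepping ahead again leads to the reversed dart.
  have hsymm : ∀ d, (next (next d).symm).symm = d := by
    intro d
    have : d.fst = o (next d).symm := huniq _ _ (ho d).symm d.adj.symm
    ext
    · exact this.symm
    · rfl
  let e : Equiv.Perm G.Dart :=
    { toFun := next
      invFun := fun d => (next d.symm).symm
      left_inv := hsymm
      right_inv := fun d => by
        have := congrArg Dart.symm (hsymm d.symm)
        simpa using this }
  obtain ⟨v⟩ := hG.nonempty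
  obtain ⟨a, -, -, hva, -⟩ := htwo v
  let d₀ : G.Dart := ⟨(v, a), hva⟩
  let D : ℤ → G.Dart := fun i => (e ^ i) d₀
  have hD : ∀ i, D (i + 1) = next (D i) := by
    intro i
    change (e ^ (i + 1)) d₀ = e ((e ^ i) d₀)
    rw [add_comm, zpow_add, zpow_one, Equiv.Perm.mul_apply]
  have hsnd : ∀ i, (D i).snd = (D (i + 1)).fst := fun i => by rw [hD]
  have ho' : ∀ i, o (D i) = (D (i + 1 + 1)).fst := fun i => by rw [← hsnd, hD]
  have hiff : ∀ i x, G.Adj (D i).fst x ↔ x = (D (i - 1)).fst ∨ x = (D (i + 1)).fst := by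
    intro i x
    obtain ⟨j, rfl⟩ : ∃ j, i = j + 1 := ⟨i - 1, by ring⟩
    rw [add_sub_cancel_right, ← ho', ← hsnd]
    constructor
    · intro h
      by_cases hx : x = (D j).fst
      · exact Or.inl hx
      · exact Or.inr (huniq _ _ hx h)
    · rintro (rfl | rfl)
      · exact (D j).adj.symm
      · exact hadj _
  refine ⟨fun i => (D i).fst, hiff, fun i => ?_, fun x => ?_, fun i j h1 h2 k => ?_⟩
  · obtain ⟨j, rfl⟩ : ∃ j, i = j + 1 := ⟨i - 1, by ring⟩
    rw [add_sub_cancel_right, ← ho']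
    exact (ho _).symm
  · refine mem_of_adj_closed hG (S := Set.range fun i => (D i).fst) ⟨0, rfl⟩ ?_ x
    rintro _ ⟨i, rfl⟩ y hy
    rcases (hiff i y).1 hy with rfl | rfl
    · exact ⟨_, rfl⟩
    · exact ⟨_, rfl⟩
  · have hij : D i = D j := by
      ext
      · exact h1
      · rw [hsnd, hsnd]
        exact h2
    have hk : ∀ i, D (i + k) = (e ^ k) (D i) := by
      intro i
      change (e ^ (i + k)) d₀ = (e ^ k) ((e ^ i) d₀)
      rw [add_comm, zpow_add, Equiv.Perm.mul_apply]
    change (D (i + k)).fst = (D (j + k)).fst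
    rw [hk, hk, hij]

theorem IsLineCover.iso_int {φ : ℤ → V} (h : IsLineCover G φ) (hinj : Function.Injective φ) :
    Nonempty (G ≃g hasse ℤ) := by
  suffices Nonempty (hasse ℤ ≃g G) from this.map RelIso.symm
  refine nonempty_iso_of_bijective φ ⟨hinj, h.surj⟩ ?_
  intro i j
  simp only [h.adj_iff, hinj.eq_iff, hasse_adj,
    Order.covBy_iff_add_one_eq]
  omega

/-- A line cover that takes a value twice is periodic: at a closest coincidence `φ i = φ j` the
walk cannot continue in opposite directions, since that would produce a closer coincidence. -/
theorem IsLineCover.exists_period {φ : ℤ → V} (h : IsLineCover G φ)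
    (hinj : ¬ Function.Injective φ) :
    ∃ n : ℕ, 3 ≤ n ∧ (∀ i, φ (i + n) = φ i) ∧
      ∀ i j : ℤ, i < j → j < i + n → φ i ≠ φ j := by
  classical
  have hex : ∃ n : ℕ, 0 < n ∧ ∃ i : ℤ, φ i = φ (i + n) := by
    simp only [Function.Injective, not_forall] at hinj
    obtain ⟨i, j, hij, hne⟩ := hinj
    rcases lt_or_gt_of_ne hne with hlt | hlt
    · exact ⟨(j - i).toNat, by omega, i, by rw [hij]; congr 1; omega⟩
    · exact ⟨(i - j).toNat, by omega, j, by rw [← hij]; congr 1; omega⟩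
  set n := Nat.find hex with hn
  obtain ⟨hpos, i, hi⟩ := Nat.find_spec hex
  rw [← hn] at hpos hi
  have hmin : ∀ i j : ℤ, i < j → j < i + n → φ i ≠ φ j := by
    intro i j hij hj heq
    refine Nat.find_min hex (m := (j - i).toNat) (by omega) ⟨by omega, i, ?_⟩
    rw [heq]; congr 1; omega
  have h1 : n ≠ 1 := by
    intro h1
    have := (h.adj_iff i (φ (i + 1))).2 (Or.inr rfl)
    rw [h1, Nat.cast_one] at hi
    exact this.ne hi
  have h2 : n ≠ 2 := by
    intro h2
    have := h.ne (i + 1)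
    rw [add_sub_cancel_right, add_assoc] at this
    rw [h2] at hi
    exact this hi
  have hadj : G.Adj (φ i) (φ (i + 1)) := (h.adj_iff _ _).2 (Or.inr rfl)
  rw [hi, h.adj_iff] at hadj
  rcases hadj with h3 | h3
  · exact absurd h3 (hmin _ _ (by omega) (by omega))
  · refine ⟨n, by omega, fun k => ?_, hmin⟩
    have := h.rigid i (i + n) hi h3 (k - i)
    rw [add_sub_cancel] at this
    rw [this]
    congr 1
    ring

theorem IsLineCover.iso_cycle {φ : ℤ → V} (h : IsLineCover G φ) {n : ℕ} (hn : 3 ≤ n)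
    (hper : ∀ i, φ (i + n) = φ i) (hmin : ∀ i j : ℤ, i < j → j < i + n → φ i ≠ φ j) :
    Nonempty (G ≃g cycleGraph n) := by
  obtain ⟨n, rfl⟩ : ∃ m, n = m + 2 := ⟨n - 2, by omega⟩
  let ψ : Fin (n + 2) → V := fun k => φ (k.val : ℤ)
  have hmod : ∀ i : ℤ, φ (i % (n + 2 : ℕ)) = φ i := by
    intro i
    have : Function.Periodic φ ((n + 2 : ℕ) : ℤ) := hper
    conv_rhs => rw [← Int.emod_add_mul_ediv i (n + 2 : ℕ), mul_comm]
    exact (this.int_mul (i / (n + 2 : ℕ)) _).symm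
  have hinj : Function.Injective ψ := by
    intro a b hab
    rcases lt_trichotomy a.val b.val with hlt | heq | hlt
    · exact absurd hab (hmin _ _ (by omega) (by omega))
    · exact Fin.ext heq
    · exact absurd hab.symm (hmin _ _ (by omega) (by omega))
  have hsurj : Function.Surjective ψ := by
    intro x
    obtain ⟨i, rfl⟩ := h.surj x
    have h0 := Int.emod_nonneg i (b := (n + 2 : ℕ)) (by omega)
    have h1 := Int.emod_lt_of_pos i (b := (n + 2 : ℕ)) (by omega)
    refine ⟨⟨(i % (n + 2 : ℕ)).toNat, by omega⟩, ?_⟩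
    change φ ((i % (n + 2 : ℕ)).toNat : ℤ) = φ i
    rw [Int.toNat_of_nonneg h0, hmod]
  have hsucc : ∀ k, ψ (k + 1) = φ ((k.val : ℤ) + 1) := by
    intro k
    change φ ((k + 1 : Fin (n + 2)).val : ℤ) = _
    rw [Fin.val_add, Int.natCast_mod, hmod]
    simp
  have hpred : ∀ k, ψ (k - 1) = φ ((k.val : ℤ) - 1) := by
    intro k
    change φ ((k - 1 : Fin (n + 2)).val : ℤ) = _
    rw [Fin.val_sub, Int.natCast_mod, hmod, ← hper (k.val - 1)]
    congr 1
    simp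
    ring
  have hfwd : ∀ a b, G.Adj (ψ a) (ψ b) ↔ ψ b = φ ((a.val : ℤ) - 1) ∨ ψ b = φ ((a.val : ℤ) + 1) :=
    fun a b => h.adj_iff _ _
  have hstep : ∀ a, G.Adj (ψ a) (ψ (a + 1)) := fun a => (hfwd _ _).2 (Or.inr (hsucc a))
  suffices Nonempty (cycleGraph (n + 2) ≃g G) from this.map RelIso.symm
  refine nonempty_iso_of_bijective ψ ⟨hinj, hsurj⟩ ?_
  intro a b
  rw [cycleGraph_adj]
  constructor
  · intro hab
    rcases (hfwd _ _).1 hab with hb | hb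
    · left
      rw [hinj (hb.trans (hpred a).symm), sub_sub_cancel]
    · right
      rw [hinj (hb.trans (hsucc a).symm), add_sub_cancel_left]
  · rintro (hab | hab)
    · rw [sub_eq_iff_eq_add'] at hab
      rw [hab]
      exact (hstep b).symm
    · rw [sub_eq_iff_eq_add'] at hab
      rw [hab]
      exact hstep a

/-! ### The model graphs of degree at most two -/

theorem atMostTwoNeighbors_pathGraph (k : ℕ) : AtMostTwoNeighbors (pathGraph k) := by
  intro x a b c ha hb hc
  rw [pathGraph_adj] at ha hb hc
  omega

theorem atMostTwoNeighbors_hasse_nat : AtMostTwoNeighbors (hasse ℕ) := by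
  intro x a b c ha hb hc
  simp only [hasse_adj, Order.covBy_iff_add_one_eq] at ha hb hc
  omega

theorem atMostTwoNeighbors_hasse_int : AtMostTwoNeighbors (hasse ℤ) := by
  intro x a b c ha hb hc
  simp only [hasse_adj, Order.covBy_iff_add_one_eq] at ha hb hc
  omega

theorem atMostTwoNeighbors_cycleGraph (n : ℕ) : AtMostTwoNeighbors (cycleGraph (n + 2)) := by
  have h : ∀ x a : Fin (n + 2), (cycleGraph (n + 2)).Adj x a → a = x - 1 ∨ a = x + 1 := by
    intro x a ha
    rw [cycleGraph_adj] at ha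
    rcases ha with ha | ha
    · left
      rw [← ha, sub_sub_cancel]
    · right
      rw [← ha, add_sub_cancel]
  intro x a b c ha hb hc
  rcases h x a ha with rfl | rfl <;> rcases h x b hb with rfl | rfl <;>
    rcases h x c hc with rfl | rfl <;> simp

/-! ### Absence of four-cycles -/

theorem eq_or_eq_of_cycleGraph_four_free (hfree : (cycleGraph 4).Free G) {x y z w : V}
    (hxy : G.Adj x y) (hyz : G.Adj y z) (hzw : G.Adj z w) (hwx : G.Adj w x) : x = z ∨ y = w := by
  by_contra! h
  refine hfree ⟨⟨⟨![x, y, z, w], ?_⟩, ?_⟩⟩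
  · intro a b hab
    rw [cycleGraph_adj] at hab
    fin_cases a <;> fin_cases b <;>
      first
      | exact absurd hab (by decide)
      | simp [hxy, hyz, hzw, hwx, hxy.symm, hyz.symm, hzw.symm, hwx.symm]
  · intro a b hab
    have h1 := hxy.ne
    have h2 := hyz.ne
    have h3 := hzw.ne
    have h4 := hwx.ne
    fin_cases a <;> fin_cases b <;> simp_all

end Classification

/-! ### The iterated carré du champ and sufficient conditions for `CD(0, ∞)` -/

section Curvature

open Finset SimpleGraph

variable {V : Type*} (G : SimpleGraph V) [G.LocallyFinite]

theorem Gam_eq (f g : V → ℝ) (x : V) :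
    Gam G f g x = (∑ y ∈ G.neighborFinset x, (f y - f x) * (g y - g x)) / 2 := by
  unfold Gam laplacian
  rw [mul_sum, mul_sum, ← sum_sub_distrib, ← sum_sub_distrib]
  congr 1
  exact sum_congr rfl fun y _ => by ring

/-- Completing the square in the values of `f` two steps away from `x`. -/
theorem four_mul_Gam2 [DecidableEq V] (f : V → ℝ) (x : V) :
    4 * Gam2 G f f x = 2 * (∑ y ∈ G.neighborFinset x, (f y - f x)) ^ 2
      + ∑ y ∈ G.neighborFinset x, (4 - G.degree y - G.degree x : ℝ) * (f y - f x) ^ 2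
      + ∑ y ∈ G.neighborFinset x, ∑ z ∈ (G.neighborFinset y).erase x,
          (f z - f x - 2 * (f y - f x)) ^ 2 := by
  have h1 : laplacian G (Gam G f f) x = (∑ y ∈ G.neighborFinset x,
      (∑ z ∈ G.neighborFinset y, (f z - f y) ^ 2
        - ∑ z ∈ G.neighborFinset x, (f z - f x) ^ 2)) / 2 := by
    unfold laplacian
    rw [sum_div]
    refine sum_congr rfl fun y _ => ?_
    simp only [Gam_eq, pow_two]
    ring
  have h2 : Gam G f (laplacian G f) x = (∑ y ∈ G.neighborFinset x,
      ((f y - f x) * ∑ z ∈ G.neighborFinset y, (f z - f y))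
        - (∑ y ∈ G.neighborFinset x, (f y - f x)) ^ 2) / 2 := by
    rw [Gam_eq, pow_two, sum_mul, ← sum_sub_distrib]
    congr 1
    exact sum_congr rfl fun y _ => by unfold laplacian; ring
  have h3 : Gam G (laplacian G f) f x = Gam G f (laplacian G f) x := by
    rw [Gam_eq, Gam_eq]
    simp only [mul_comm]
  -- Adding back the term `z = x`, which is `4 (f y - f x) ^ 2`, makes the inner sum run over all of
  -- the neighbours of `y`.
  have h4 : ∀ y ∈ G.neighborFinset x, ∑ z ∈ (G.neighborFinset y).erase x,
      (f z - f x - 2 * (f y - f x)) ^ 2 = ∑ z ∈ G.neighborFinset y, (f z - f y) ^ 2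
        - 2 * ((f y - f x) * ∑ z ∈ G.neighborFinset y, (f z - f y))
        + (G.degree y - 4) * (f y - f x) ^ 2 := by
    intro y hy
    have hx : x ∈ G.neighborFinset y := by
      rw [mem_neighborFinset] at hy ⊢
      exact hy.symm
    rw [← add_left_inj ((f x - f x - 2 * (f y - f x)) ^ 2),
      sum_erase_add (G.neighborFinset y) _ hx, mul_sum, mul_sum]
    have : ∀ z, (f z - f x - 2 * (f y - f x)) ^ 2
        = (f z - f y) ^ 2 - 2 * ((f y - f x) * (f z - f y)) + (f y - f x) ^ 2 := fun z => by ring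
    simp only [this]
    rw [sum_add_distrib, sum_sub_distrib, sum_const, card_neighborFinset_eq_degree, nsmul_eq_mul]
    ring
  rw [sum_sub_distrib, sum_const, card_neighborFinset_eq_degree, nsmul_eq_mul] at h1
  generalize ∑ y ∈ G.neighborFinset x, (f y - f x) = D at h2 ⊢
  rw [sum_congr rfl h4, sum_add_distrib, sum_sub_distrib, ← mul_sum]
  unfold Gam2
  rw [h3, h1, h2]
  have h5 : ∑ y ∈ G.neighborFinset x, (4 - G.degree y - G.degree x : ℝ) * (f y - f x) ^ 2
      + ∑ y ∈ G.neighborFinset x, (G.degree y - 4 : ℝ) * (f y - f x) ^ 2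
      = - (G.degree x * ∑ y ∈ G.neighborFinset x, (f y - f x) ^ 2) := by
    rw [← sum_add_distrib, mul_sum, ← sum_neg_distrib]
    exact sum_congr rfl fun y _ => by ring
  linear_combination -h5

theorem CD_zero_top_iff : CD G 0 ⊤ ↔ ∀ x f, 0 ≤ Gam2 G f f x := by
  simp [CD, CDAt]

theorem CD_of_degree_add_le (h : ∀ x y, G.Adj x y → G.degree x + G.degree y ≤ 4) :
    CD G 0 ⊤ := by
  classical
  rw [CD_zero_top_iff]
  intro x f
  have h1 := four_mul_Gam2 G f x
  have h2 : 0 ≤ ∑ y ∈ G.neighborFinset x,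
      (4 - G.degree y - G.degree x : ℝ) * (f y - f x) ^ 2 := by
    refine sum_nonneg fun y hy => mul_nonneg ?_ (sq_nonneg _)
    have : (G.degree x + G.degree y : ℝ) ≤ 4 := by
      exact_mod_cast h x y ((G.mem_neighborFinset x y).1 hy)
    linarith
  have h3 : 0 ≤ ∑ y ∈ G.neighborFinset x, ∑ z ∈ (G.neighborFinset y).erase x,
      (f z - f x - 2 * (f y - f x)) ^ 2 :=
    sum_nonneg fun y _ => sum_nonneg fun z _ => sq_nonneg _
  nlinarith [sq_nonneg (∑ y ∈ G.neighborFinset x, (f y - f x))]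

variable {G} in
theorem laplacian_comp_iso {W : Type*} {H : SimpleGraph W} [H.LocallyFinite] (e : G ≃g H)
    (f : W → ℝ) (x : V) : laplacian G (fun v => f (e v)) x = laplacian H f (e x) := by
  unfold laplacian
  refine sum_bij (fun y _ => e y) ?_ ?_ ?_ ?_
  · intro y hy
    rw [mem_neighborFinset] at hy ⊢
    exact e.map_adj_iff.2 hy
  · exact fun a _ b _ h => e.injective h
  · intro b hb
    rw [mem_neighborFinset] at hb
    obtain ⟨y, rfl⟩ := e.surjective b
    exact ⟨y, by rwa [mem_neighborFinset, ← e.map_adj_iff], rfl⟩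
  · exact fun _ _ => rfl

variable {G} in
theorem CD_of_iso {W : Type*} {H : SimpleGraph W} [H.LocallyFinite] (e : G ≃g H)
    (h : CD H 0 ⊤) : CD G 0 ⊤ := by
  rw [CD_zero_top_iff] at h ⊢
  intro x f
  obtain ⟨f, rfl⟩ : ∃ f' : W → ℝ, f = fun v => f' (e v) := ⟨fun w => f (e.symm w), by simp⟩
  have hΓ : ∀ f g : W → ℝ, Gam G (fun v => f (e v)) (fun v => g (e v))
      = fun v => Gam H f g (e v) := by
    intro f g
    funext v
    unfold Gam
    rw [← laplacian_comp_iso e, ← laplacian_comp_iso e, ← laplacian_comp_iso e]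
  have hΔ : ∀ f : W → ℝ, laplacian G (fun v => f (e v)) = fun v => laplacian H f (e v) :=
    fun f => funext (laplacian_comp_iso e f)
  have : Gam2 G (fun v => f (e v)) (fun v => f (e v)) x = Gam2 H f f (e x) := by
    unfold Gam2
    rw [hΔ, hΓ, hΓ, hΓ, laplacian_comp_iso e]
  rw [this]
  exact h _ _

theorem CD_of_atMostTwoNeighbors (h : AtMostTwoNeighbors G) : CD G 0 ⊤ := by
  have hd : ∀ x, G.degree x ≤ 2 := by
    intro x
    by_contra! hx
    rw [← card_neighborFinset_eq_degree, two_lt_card] at hx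
    simp only [mem_neighborFinset] at hx
    obtain ⟨a, ha, b, hb, c, hc, hab, hac, hbc⟩ := hx
    rcases h x a b c ha hb hc with h | h | h
    exacts [hab h, hac h, hbc h]
  exact CD_of_degree_add_le G fun x y _ => by have := hd x; have := hd y; omega

variable {G} in
theorem CD_of_iso_of_atMostTwoNeighbors {W : Type*} {H : SimpleGraph W} (e : G ≃g H)
    (h : AtMostTwoNeighbors H) : CD G 0 ⊤ :=
  CD_of_atMostTwoNeighbors G fun x a b c ha hb hc => by
    simpa using h (e x) (e a) (e b) (e c) (e.map_adj_iff.2 ha) (e.map_adj_iff.2 hb)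
      (e.map_adj_iff.2 hc)

theorem CD_starGraph : CD (starGraph (0 : Fin 4)) 0 ⊤ :=
  CD_of_degree_add_le _ (by decide)

instance : DecidableRel trianglePendant.Adj := by
  unfold trianglePendant
  infer_instance

theorem CD_trianglePendant : CD trianglePendant 0 ⊤ := by
  rw [CD_zero_top_iff]
  intro x f
  have h := four_mul_Gam2 trianglePendant f x
  have n0 : trianglePendant.neighborFinset 0 = {1, 2, 3} := by decide
  have n1 : trianglePendant.neighborFinset 1 = {0, 2} := by decide
  have n2 : trianglePendant.neighborFinset 2 = {0, 1} := by decide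
  have n3 : trianglePendant.neighborFinset 3 = {0} := by decide
  have e0 : ({1, 2, 3} : Finset (Fin 4)).erase 1 = {2, 3} := by decide
  have e1 : ({1, 2, 3} : Finset (Fin 4)).erase 2 = {1, 3} := by decide
  have e2 : ({1, 2, 3} : Finset (Fin 4)).erase 3 = {1, 2} := by decide
  have e3 : ({0, 2} : Finset (Fin 4)).erase 0 = {2} := by decide
  have e4 : ({0, 2} : Finset (Fin 4)).erase 2 = {0} := by decide
  have e5 : ({0, 1} : Finset (Fin 4)).erase 0 = {1} := by decide
  have e6 : ({0, 1} : Finset (Fin 4)).erase 1 = {0} := by decide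
  have e7 : ({0} : Finset (Fin 4)).erase 0 = ∅ := by decide
  have d0 : trianglePendant.degree 0 = 3 := by decide
  have d1 : trianglePendant.degree 1 = 2 := by decide
  have d2 : trianglePendant.degree 2 = 2 := by decide
  have d3 : trianglePendant.degree 3 = 1 := by decide
  fin_cases x <;>
    simp [n0, n1, n2, n3, e0, e1, e2, e3, e4, e5, e6, e7, d0, d1, d2, d3] at h ⊢
  · nlinarith [sq_nonneg (f 1 + (f 2 + f 3) - 3 * f 0), sq_nonneg (f 1 - f 2)]
  · nlinarith [sq_nonneg (f 3 - f 1 - 2 * (f 0 - f 1)), sq_nonneg (f 0 - f 2),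
      sq_nonneg (f 0 - f 1), sq_nonneg (f 2 - f 1)]
  · nlinarith [sq_nonneg (f 3 - f 2 - 2 * (f 0 - f 2)), sq_nonneg (f 0 - f 1),
      sq_nonneg (f 0 - f 2), sq_nonneg (f 1 - f 2)]
  · nlinarith [sq_nonneg (f 0 - f 3), sq_nonneg (f 1 - f 3 - 2 * (f 0 - f 3)),
      sq_nonneg (f 2 - f 3 - 2 * (f 0 - f 3))]

/-! ### Consequences of `CD(0, ∞)` at vertices of degree at least three -/

variable {G}

theorem card_common_le_one [DecidableEq V] (hfree : (cycleGraph 4).Free G) {x y : V}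
    (hxy : G.Adj x y) : #(G.neighborFinset y ∩ G.neighborFinset x) ≤ 1 := by
  rw [card_le_one]
  intro z hz w hw
  simp only [mem_inter, mem_neighborFinset] at hz hw
  exact (eq_or_eq_of_cycleGraph_four_free hfree hz.1 hz.2.symm hw.2 hw.1.symm).resolve_left
    hxy.ne'

/-- The test functions that vanish at `x` and take, two steps away from `x`, twice the value of the
intermediate neighbour of `x`, which is unique in the absence of `C₄`. -/
theorem CD.sum_nonneg [DecidableEq V] (hCD : CD G 0 ⊤) (hfree : (cycleGraph 4).Free G) (x : V)
    (a : V → ℝ) (ha : ∀ y z, G.Adj x y → G.Adj x z → G.Adj y z → a y = a z)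
    (h0 : ∑ y ∈ G.neighborFinset x, a y = 0) :
    0 ≤ ∑ y ∈ G.neighborFinset x, (4 - G.degree y - G.degree x
      + #(G.neighborFinset y ∩ G.neighborFinset x) : ℝ) * a y ^ 2 := by
  classical
  -- Two steps away from `x`, the chosen intermediate neighbour is the only one, by `fz` below.
  let f : V → ℝ := fun z => if z = x then 0 else if G.Adj x z then a z else
    if h : ∃ y, G.Adj x y ∧ G.Adj y z then 2 * a h.choose else 0
  have fx : f x = 0 := by simp [f]
  have fy : ∀ y, G.Adj x y → f y = a y := fun y hy => by simp [f, hy, hy.ne']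
  have fz : ∀ y z, G.Adj x y → G.Adj y z → z ≠ x → ¬ G.Adj x z → f z = 2 * a y := by
    intro y z hxy hyz hzx hxz
    have h : ∃ y, G.Adj x y ∧ G.Adj y z := ⟨y, hxy, hyz⟩
    have : h.choose = y := (eq_or_eq_of_cycleGraph_four_free hfree h.choose_spec.1
      h.choose_spec.2 hyz.symm hxy.symm).resolve_left hzx.symm
    simp only [f, if_neg hzx, if_neg hxz, dif_pos h, this]
  have key := four_mul_Gam2 G f x
  have hpos := (CD_zero_top_iff G).1 hCD x f
  have h1 : ∑ y ∈ G.neighborFinset x, (f y - f x) = 0 := by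
    rw [← h0]
    exact sum_congr rfl fun y hy => by rw [fx, fy y ((G.mem_neighborFinset _ _).1 hy), sub_zero]
  have h2 : ∀ y ∈ G.neighborFinset x, ∑ z ∈ (G.neighborFinset y).erase x,
      (f z - f x - 2 * (f y - f x)) ^ 2
        = #(G.neighborFinset y ∩ G.neighborFinset x) * a y ^ 2 := by
    intro y hy
    rw [mem_neighborFinset] at hy
    have : ∀ z ∈ (G.neighborFinset y).erase x, (f z - f x - 2 * (f y - f x)) ^ 2
        = if G.Adj x z then a y ^ 2 else 0 := by
      intro z hz
      rw [mem_erase, mem_neighborFinset] at hz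
      split_ifs with hxz
      · rw [fx, fy y hy, fy z hxz, ha y z hy hxz hz.2]
        ring
      · rw [fx, fy y hy, fz y z hy hz.2 hz.1 hxz]
        ring
    rw [sum_congr rfl this, ← sum_filter, sum_const, nsmul_eq_mul]
    congr 3
    ext z
    simp only [mem_filter, mem_erase, mem_inter, mem_neighborFinset]
    exact ⟨fun h => ⟨h.1.2, h.2⟩, fun h => ⟨⟨h.2.ne', h.1⟩, h.2⟩⟩
  have h3 : ∑ y ∈ G.neighborFinset x, (4 - G.degree y - G.degree x : ℝ) * (f y - f x) ^ 2
      = ∑ y ∈ G.neighborFinset x, (4 - G.degree y - G.degree x : ℝ) * a y ^ 2 :=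
    sum_congr rfl fun y hy => by rw [fx, fy y ((G.mem_neighborFinset _ _).1 hy), sub_zero]
  rw [h1, h3, sum_congr rfl h2] at key
  simp only [add_mul _ (Nat.cast _), sum_add_distrib]
  linarith

/-- Apply the inequality to a function with zero sum over the neighbours of `x`, constant on the
triangles at `x` and nowhere zero: it takes one value on a neighbour `y` and its possible partner
in a triangle, and another one on the remaining neighbours. Every term of the sum is at most
`(3 - deg x) a²`, so all of them vanish when `deg x ≥ 3`. -/
theorem CD.of_three_le_degree (hCD : CD G 0 ⊤) (hfree : (cycleGraph 4).Free G) {x : V}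
    (hx : 3 ≤ G.degree x) :
    G.degree x = 3 ∧ ∀ y z, G.Adj x y → G.Adj y z → z = x ∨ G.Adj x z := by
  classical
  have hins : ∀ y, G.Adj x y →
      insert x (G.neighborFinset y ∩ G.neighborFinset x) ⊆ G.neighborFinset y := by
    intro y hy
    refine insert_subset ?_ inter_subset_left
    rw [mem_neighborFinset]
    exact hy.symm
  have hcard : ∀ y, #(insert x (G.neighborFinset y ∩ G.neighborFinset x))
      = #(G.neighborFinset y ∩ G.neighborFinset x) + 1 := fun y =>
    card_insert_of_notMem (by simp)
  have hdeg : ∀ y, G.Adj x y →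
      #(G.neighborFinset y ∩ G.neighborFinset x) + 1 ≤ G.degree y := by
    intro y hy
    rw [← card_neighborFinset_eq_degree, ← hcard]
    exact card_le_card (hins y hy)
  obtain ⟨y₀, hy₀⟩ : ∃ y₀, G.Adj x y₀ := by
    have : 0 < G.degree x := by omega
    rwa [degree_pos_iff_exists_adj] at this
  -- `y₀` together with its possible partner in a triangle at `x`
  let P : V → Prop := fun v => v = y₀ ∨ G.Adj v y₀
  have hP : ∀ y z, G.Adj x y → G.Adj x z → G.Adj y z → P y → P z := by
    rintro y z hy hz hyz (rfl | h)
    · exact Or.inr hyz.symm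
    · exact Or.inl ((eq_or_eq_of_cycleGraph_four_free hfree hz hyz.symm h
        hy₀.symm).resolve_left hy.ne)
  let C := (G.neighborFinset x).filter P
  have hCpos : 0 < #C := card_pos.2 ⟨y₀, by simp [C, P, hy₀]⟩
  have hCle : #C ≤ 2 := by
    have : C ⊆ insert y₀ (G.neighborFinset y₀ ∩ G.neighborFinset x) := by
      intro v hv
      simp only [C, P, mem_filter, mem_neighborFinset] at hv
      simp only [mem_insert, mem_inter, mem_neighborFinset]
      exact hv.2.imp_right fun h => ⟨h.symm, hv.1⟩
    have h1 := card_common_le_one hfree hy₀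
    have h2 := card_insert_le y₀ (G.neighborFinset y₀ ∩ G.neighborFinset x)
    have h3 := card_le_card this
    omega
  -- The two values are weighted by the sizes of the opposite parts, for the sum to vanish.
  let a : V → ℝ := fun v => if P v then G.degree x - #C else - #C
  have hCR : (0 : ℝ) < #C := by exact_mod_cast hCpos
  have hCx : (#C : ℝ) < G.degree x := by
    have : #C < G.degree x := by omega
    exact_mod_cast this
  have ha : ∀ v, 0 < a v ^ 2 := by
    intro v
    refine sq_pos_of_ne_zero ?_
    simp only [a]
    split_ifs
    · linarith
    · linarith
  have hsum : ∑ y ∈ G.neighborFinset x, a y = 0 := by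
    have : ∀ v, a v = (if P v then (G.degree x : ℝ) else 0) - #C := by
      intro v
      simp only [a]
      split_ifs <;> ring
    simp only [this]
    rw [sum_sub_distrib, ← sum_filter, sum_const, sum_const, card_neighborFinset_eq_degree,
      nsmul_eq_mul, nsmul_eq_mul]
    ring
  have hmain := hCD.sum_nonneg hfree x a (fun y z hy hz hyz => by
    have : P y ↔ P z := ⟨hP y z hy hz hyz, hP z y hz hy hyz.symm⟩
    simp only [a, this]) hsum
  have hcoef : ∀ y, G.Adj x y → (4 - G.degree y - G.degree x
      + #(G.neighborFinset y ∩ G.neighborFinset x) : ℝ) ≤ 0 := by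
    intro y hy
    have h1 : (#(G.neighborFinset y ∩ G.neighborFinset x) + 1 : ℝ) ≤ G.degree y := by
      exact_mod_cast hdeg y hy
    have h2 : (3 : ℝ) ≤ G.degree x := by exact_mod_cast hx
    linarith
  have hterm : ∀ y ∈ G.neighborFinset x, (4 - G.degree y - G.degree x
      + #(G.neighborFinset y ∩ G.neighborFinset x) : ℝ) * a y ^ 2 ≤ 0 := fun y hy =>
    mul_nonpos_of_nonpos_of_nonneg (hcoef y ((G.mem_neighborFinset _ _).1 hy)) (ha y).le
  have hzero : ∀ y, G.Adj x y → 4 + #(G.neighborFinset y ∩ G.neighborFinset x)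
      = G.degree y + G.degree x := by
    intro y hy
    have h1 := (sum_eq_zero_iff_of_nonpos hterm).1 (le_antisymm (sum_nonpos hterm) hmain) y
      ((G.mem_neighborFinset _ _).2 hy)
    have h2 := (mul_eq_zero.1 h1).resolve_right (ha y).ne'
    have h3 : (4 + #(G.neighborFinset y ∩ G.neighborFinset x) : ℝ)
      = G.degree y + G.degree x := by linarith
    exact_mod_cast h3
  refine ⟨?_, fun y z hy hz => ?_⟩
  · have h1 := hzero _ hy₀
    have h2 := hdeg _ hy₀
    omega
  · have h1 := hzero _ hy
    have h2 := hdeg _ hy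
    have h3 := eq_of_subset_of_card_le (hins y hy) (by
      rw [card_neighborFinset_eq_degree, hcard]; omega)
    have h4 := (G.mem_neighborFinset y z).2 hz
    rw [← h3, mem_insert, mem_inter, mem_neighborFinset, mem_neighborFinset] at h4
    exact h4.imp_right And.right

theorem star_or_trianglePendant (hG : G.Connected) (hCD : CD G 0 ⊤)
    (hfree : (cycleGraph 4).Free G) {x : V} (hx : 3 ≤ G.degree x) :
    Nonempty (G ≃g starGraph (0 : Fin 4)) ∨ Nonempty (G ≃g trianglePendant) := by
  classical
  obtain ⟨h3, hball⟩ := hCD.of_three_le_degree hfree hx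
  rw [← card_neighborFinset_eq_degree, card_eq_three] at h3
  obtain ⟨p, q, r, hpq, hpr, hqr, hN⟩ := h3
  have hadj : ∀ v, G.Adj x v ↔ v = p ∨ v = q ∨ v = r := by
    intro v
    rw [← mem_neighborFinset, hN]
    simp
  have hcover : ∀ v, v = x ∨ v = p ∨ v = q ∨ v = r := by
    intro v
    rw [← hadj]
    refine mem_of_adj_closed hG (S := {v | v = x ∨ G.Adj x v}) (Or.inl rfl) ?_ v
    rintro y (rfl | hy) z hz
    · exact Or.inr hz
    · exact hball y z hy hz
  -- An isomorphism onto a graph on `Fin 4` with center `0`, for any order of the three neighbours.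
  have iso : ∀ (H : SimpleGraph (Fin 4)) (p q r : V), p ≠ q → p ≠ r → q ≠ r →
      (∀ v, G.Adj x v ↔ v = p ∨ v = q ∨ v = r) → (∀ v, v = x ∨ v = p ∨ v = q ∨ v = r) →
      H.Adj 0 1 → H.Adj 0 2 → H.Adj 0 3 → (G.Adj p q ↔ H.Adj 1 2) → (G.Adj p r ↔ H.Adj 1 3) →
      (G.Adj q r ↔ H.Adj 2 3) → Nonempty (G ≃g H) := by
    intro H p q r hpq hpr hqr hadj hcover h01 h02 h03 h12 h13 h23
    have hp : G.Adj x p := (hadj p).2 (by simp)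
    have hq : G.Adj x q := (hadj q).2 (by simp)
    have hr : G.Adj x r := (hadj r).2 (by simp)
    suffices Nonempty (H ≃g G) from this.map RelIso.symm
    refine nonempty_iso_of_bijective ![x, p, q, r] ⟨?_, fun v => ?_⟩ ?_
    · intro a b hab
      have := hp.ne
      have := hq.ne
      have := hr.ne
      fin_cases a <;> fin_cases b <;> simp_all
    · rcases hcover v with rfl | rfl | rfl | rfl
      exacts [⟨0, rfl⟩, ⟨1, rfl⟩, ⟨2, rfl⟩, ⟨3, rfl⟩]
    · intro a b
      fin_cases a <;> fin_cases b <;>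
        simp [hp, hq, hr, hp.symm, hq.symm, hr.symm, h01, h02, h03, h01.symm, h02.symm, h03.symm,
          h12, h13, h23, G.adj_comm q p, G.adj_comm r p, G.adj_comm r q, H.adj_comm 2 1,
          H.adj_comm 3 1, H.adj_comm 3 2]
  have huniq : ∀ a b c, G.Adj x a → G.Adj x b → G.Adj x c → b ≠ c → G.Adj a b → ¬ G.Adj a c :=
    fun a b c ha hb hc hbc hab hac => (eq_or_eq_of_cycleGraph_four_free hfree hb hab.symm hac
      hc.symm).elim ha.ne hbc
  have hp : G.Adj x p := (hadj p).2 (by simp)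
  have hq : G.Adj x q := (hadj q).2 (by simp)
  have hr : G.Adj x r := (hadj r).2 (by simp)
  have t1 : trianglePendant.Adj 0 1 := by decide
  have t2 : trianglePendant.Adj 0 2 := by decide
  have t3 : trianglePendant.Adj 0 3 := by decide
  have t4 : trianglePendant.Adj 1 2 := by decide
  have t5 : ¬ trianglePendant.Adj 1 3 := by decide
  have t6 : ¬ trianglePendant.Adj 2 3 := by decide
  by_cases e1 : G.Adj p q
  · right
    exact iso _ p q r hpq hpr hqr hadj hcover t1 t2 t3 (iff_of_true e1 t4)
      (iff_of_false (huniq p q r hp hq hr hqr e1) t5)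
      (iff_of_false (huniq q p r hq hp hr hpr e1.symm) t6)
  by_cases e2 : G.Adj p r
  · right
    exact iso _ p r q hpr hpq hqr.symm (fun v => by rw [hadj]; tauto)
      (fun v => by have := hcover v; tauto) t1 t2 t3 (iff_of_true e2 t4) (iff_of_false e1 t5)
      (iff_of_false (huniq r p q hr hp hq hpq e2.symm) t6)
  by_cases e3 : G.Adj q r
  · right
    exact iso _ q r p hqr hpq.symm hpr.symm (fun v => by rw [hadj]; tauto)
      (fun v => by have := hcover v; tauto) t1 t2 t3 (iff_of_true e3 t4)
      (iff_of_false (fun h => e1 h.symm) t5) (iff_of_false (fun h => e2 h.symm) t6)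
  · left
    exact iso _ p q r hpq hpr hqr hadj hcover (by simp) (by simp) (by simp)
      (iff_of_false e1 (by simp)) (iff_of_false e2 (by simp)) (iff_of_false e3 (by simp))

theorem atMostTwoNeighbors_of_degree_le (h : ∀ x, G.degree x ≤ 2) : AtMostTwoNeighbors G := by
  classical
  intro x a b c ha hb hc
  by_contra! hne
  have h1 : #{a, b, c} ≤ #(G.neighborFinset x) := by
    refine card_le_card fun v hv => ?_
    rw [mem_neighborFinset]
    simp only [mem_insert, mem_singleton] at hv
    rcases hv with rfl | rfl | rfl <;> assumption
  rw [card_eq_three.2 ⟨a, b, c, hne.1, hne.2.1, hne.2.2, rfl⟩, card_neighborFinset_eq_degree] at h1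
  have := h x
  omega

end Curvature

end BakryEmery

/-! ### The classification -/

theorem theorem2p5 {V : Type*} (G : SimpleGraph V) [G.LocallyFinite]
    (hconn : G.Connected) (hfree : (SimpleGraph.cycleGraph 4).Free G) :
    BakryEmery.CD G 0 ⊤ ↔
      ((∃ k : ℕ, 1 ≤ k ∧ Nonempty (G ≃g SimpleGraph.pathGraph k)) ∨
        (∃ n : ℕ, 5 ≤ n ∧ Nonempty (G ≃g SimpleGraph.cycleGraph n)) ∨
        Nonempty (G ≃g SimpleGraph.hasse ℤ) ∨
        Nonempty (G ≃g SimpleGraph.hasse ℕ)) ∨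
      Nonempty (G ≃g SimpleGraph.starGraph (0 : Fin 4)) ∨
      (Nonempty (G ≃g SimpleGraph.cycleGraph 3) ∨
        Nonempty (G ≃g BakryEmery.trianglePendant)) := by
  open BakryEmery SimpleGraph in
  constructor
  · intro hCD
    by_cases hdeg : ∃ x, 3 ≤ G.degree x
    · obtain ⟨x, hx⟩ := hdeg
      rcases star_or_trianglePendant hconn hCD hfree hx with h | h
      · exact Or.inr (Or.inl h)
      · exact Or.inr (Or.inr (Or.inr h))
    have htwo : AtMostTwoNeighbors G :=
      atMostTwoNeighbors_of_degree_le fun x => by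
        by_contra h
        exact hdeg ⟨x, by omega⟩
    by_cases hend : ∃ v, ∀ a b, G.Adj v a → G.Adj v b → a = b
    · obtain ⟨v, hv⟩ := hend
      rcases path_or_ray hconn htwo hv with h | h
      · exact Or.inl (Or.inl h)
      · exact Or.inl (Or.inr (Or.inr (Or.inr h)))
    obtain ⟨φ, hφ⟩ := exists_isLineCover hconn htwo fun v => by
      by_contra! h
      exact hend ⟨v, fun a b ha hb => by
        by_contra hab
        exact h a b hab ha hb⟩
    by_cases hinj : Function.Injective φ
    · exact Or.inl (Or.inr (Or.inr (Or.inl (hφ.iso_int hinj))))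
    obtain ⟨n, hn, hper, hmin⟩ := hφ.exists_period hinj
    have hiso := hφ.iso_cycle hn hper hmin
    rcases (by omega : n = 3 ∨ n = 4 ∨ 5 ≤ n) with rfl | rfl | h5
    · exact Or.inr (Or.inr (Or.inl hiso))
    · exact absurd (hiso.map fun e => e.symm.toCopy) hfree
    · exact Or.inl (Or.inr (Or.inl ⟨n, h5, hiso⟩))
  · rintro ((⟨k, -, ⟨e⟩⟩ | ⟨n, hn, ⟨e⟩⟩ | ⟨⟨e⟩⟩ | ⟨⟨e⟩⟩) | ⟨⟨e⟩⟩ | ⟨⟨e⟩⟩ | ⟨⟨e⟩⟩)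
    · exact CD_of_iso_of_atMostTwoNeighbors e (atMostTwoNeighbors_pathGraph k)
    · obtain ⟨m, rfl⟩ : ∃ m, n = m + 2 := ⟨n - 2, by omega⟩
      exact CD_of_iso_of_atMostTwoNeighbors e (atMostTwoNeighbors_cycleGraph m)
    · exact CD_of_iso_of_atMostTwoNeighbors e atMostTwoNeighbors_hasse_int
    · exact CD_of_iso_of_atMostTwoNeighbors e atMostTwoNeighbors_hasse_nat
    · exact CD_of_iso e CD_starGraph
    · exact CD_of_iso_of_atMostTwoNeighbors e (atMostTwoNeighbors_cycleGraph 1)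
    · exact CD_of_iso e CD_trianglePendant
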